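/- Let $K$ be an algebraically closed field (of any characteristic). For a nonzero form $F\in K[x_0,x_1,x_2,x_3]$ of degree $d\ge 1$ let $X=\{F=0\}\subset\mathbb{P}^3_K$ be the surface of degree $d$ that it defines, and let $\mathrm{Sing}(X)$ be the set of points of $\mathbb{P}^3_K$ at which $F$ and all its partial derivatives $\partial F/\partial x_i$ vanish. The multiplicity of $X$ at a point $p\in\mathbb{P}^3_K$ is the order of vanishing of $F$ at a vector representing $p$ (equivalently, of a local equation of $X$ at $p$). The surface $X$ is called normal if $F$ is irreducible and $\mathrm{Sing}(X)$ is finite. 1. Let $X$ be a quartic surface ($d=4$) such that $\mathrm{Sing}(X)$ is a finite set. If $X$ has a triple point (a point of multiplicity $3$), then $|\mathrm{Sing}(X)|\le 7$. 2. More generally, let $X$ be a normal monoid of degree $d\geq 1$, that is, a normal surface of degree $d$ in $\mathbb{P}^3_K$ possessing a point of multiplicity $d-1$. Then $|\mathrm{Sing}(X)|\le 1+\frac{d(d-1)}{2}$. -/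

import Mathlib

open MvPolynomial

/-- Projective 3-space over `K`: lines through the origin in `K⁴`. -/
abbrev P3 (K : Type*) [Field K] : Type _ := Projectivization K (Fin 4 → K)

/-- The singular locus of the surface `{F = 0} ⊂ ℙ³`, for a form `F`: the points at which `F` and
all its first partial derivatives vanish. (For homogeneous `F` these conditions do not depend on
the chosen representative of the point. The vanishing of `F` itself is part of the definition,
since it need not follow from that of the partial derivatives in positive characteristic.) -/
def singLocus {K : Type*} [Field K] (F : MvPolynomial (Fin 4) K) : Set (P3 K) :=
  {p | eval p.rep F = 0 ∧ ∀ i, eval p.rep (pderiv i F) = 0}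

/-- The order of vanishing of `F` at the vector `v`: the lowest degree of a nonzero term of the
Taylor expansion `F(v + y)` in `y` (it is `⊤` for `F = 0`, and `0` if `F(v) ≠ 0`). -/
noncomputable def orderAt {K : Type*} [Field K] (F : MvPolynomial (Fin 4) K) (v : Fin 4 → K) :
    ℕ∞ :=
  MvPowerSeries.order
    ((aeval (fun i => C (v i) + X i) F : MvPolynomial (Fin 4) K) : MvPowerSeries (Fin 4) K)

/-- The multiplicity of the surface `{F = 0} ⊂ ℙ³` at the point `p`, for a form `F`: the order of
vanishing of `F` at a vector representing `p`. Since `F` is homogeneous, this is the same for all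
representatives, and equals the order at `p` of the equation of the surface in any affine chart
containing `p`. -/
noncomputable def multiplicityAt {K : Type*} [Field K] (F : MvPolynomial (Fin 4) K) (p : P3 K) :
    ℕ∞ :=
  orderAt F p.rep

/-- The surface `{F = 0} ⊂ ℙ³` is normal: it is irreducible (and reduced) and has only finitely
many singular points. -/
def IsNormalSurface {K : Type*} [Field K] (F : MvPolynomial (Fin 4) K) : Prop :=
  Irreducible F ∧ (singLocus F).Finite

/-! With the point of multiplicity `m = d - 1` moved to the vertex `(1 : 0 : 0 : 0)`, the equation
becomes `x₀ A + B` with plane forms `A ≠ 0`, `B` of degrees `m`, `m + 1`; irreducibility makes them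
coprime. A singular point `(w : q)` other than the vertex satisfies `A(q) = B(q) = 0` and `w dA + dB
= 0` at `q`, so a direction tangent to `A` at `q` is also tangent to `B`. Two such points over the
same `q` would give `dA = dB = 0` there, hence a whole line of singular points. So the `q` are
distinct, and Bézout, counting each of them twice, leaves at most `m (m + 1) / 2`
(`two_mul_card_le_of_tangent`); the vertex adds 1.

The Bézout bound is a dimension count. In large degree the ideal `(A, B)` has codimension at most `m
* n` by the Koszul complex, while it satisfies two independent conditions, a value and a derivative,
at each point.

For quartics, irreducibility follows from finiteness: two factors would meet along a curve of
singular points, which meets every plane. -/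

namespace MvPolynomial

/-! ### Forms, their divisors, and heights of maximal ideals -/

section General

variable {K : Type*} [Field K] {σ τ : Type*}

theorem IsHomogeneous.eval_smul {F : MvPolynomial σ K} {d : ℕ} (hF : F.IsHomogeneous d) (c : K)
    (v : σ → K) : eval (c • v) F = c ^ d * eval v F := by
  classical
  rw [eval_eq, eval_eq, Finset.mul_sum]
  refine Finset.sum_congr rfl fun s hs => ?_
  have hd : ∑ i ∈ s.support, s i = d := by
    rw [hF.degree_eq_sum_deg_support hs]
  simp only [Pi.smul_apply, smul_eq_mul, mul_pow, Finset.prod_mul_distrib]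
  rw [Finset.prod_pow_eq_pow_sum, hd]
  ring

theorem IsHomogeneous.homogeneousComponent_mul {A W : MvPolynomial σ K} {m : ℕ}
    (hA : A.IsHomogeneous m) (r : ℕ) :
    homogeneousComponent (m + r) (A * W) = A * homogeneousComponent r W := by
  let : GradedAlgebra (homogeneousSubmodule σ K) := gradedAlgebra
  have := DirectSum.coe_decompose_mul_add_of_left_mem (homogeneousSubmodule σ K) (i := m) (j := r)
    (a := A) (b := W) hA
  have h : ∀ (P : MvPolynomial σ K) (i : ℕ),
      (DirectSum.decompose (homogeneousSubmodule σ K) P i : MvPolynomial σ K) =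
        homogeneousComponent i P := fun P i => decomposition.decompose'_apply P i
  rwa [h, h] at this

/-- Taking the component of degree `m + r` gives `A * W = A * W_r`, and `A` cancels. -/
theorem IsHomogeneous.of_mul_left {A W : MvPolynomial σ K} {m r : ℕ} (hA : A.IsHomogeneous m)
    (h0 : A ≠ 0) (h : (A * W).IsHomogeneous (m + r)) : W.IsHomogeneous r := by
  have h1 := hA.homogeneousComponent_mul (W := W) r
  rw [homogeneousComponent_eq_self h] at h1
  rw [mul_left_cancel₀ h0 h1]
  exact homogeneousComponent_isHomogeneous r W

theorem totalDegree_aeval_le {F : MvPolynomial σ K} {g : σ → MvPolynomial τ K}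
    (hg : ∀ i, (g i).totalDegree ≤ 1) : (aeval g F).totalDegree ≤ F.totalDegree := by
  rw [aeval_def, eval₂_eq]
  refine totalDegree_finsetSum_le fun s hs => ?_
  refine (totalDegree_mul _ _).trans ?_
  rw [algebraMap_eq, totalDegree_C, zero_add]
  refine (totalDegree_finsetProd _ _).trans ?_
  refine le_trans (Finset.sum_le_sum fun i _ => ?_) (le_totalDegree hs)
  exact (totalDegree_pow _ _).trans (by nlinarith [hg i])

/-- A divisor of a nonzero form that does not vanish at the origin is a constant. -/
theorem IsHomogeneous.isUnit_of_dvd [Infinite K] {F G : MvPolynomial σ K} {d : ℕ}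
    (hF : F.IsHomogeneous d) (h0 : F ≠ 0) (hG : G ∣ F) (hG0 : eval 0 G ≠ 0) : IsUnit G := by
  obtain ⟨H, rfl⟩ := hG
  suffices h : G = C (eval 0 G) by
    rw [h]
    exact (IsUnit.mk0 _ hG0).map C
  -- Where `F(v) ≠ 0`, the restriction of `F` to the line `t ↦ t v` is a nonzero multiple of `t ^
  -- d`, so that of `G` is a multiple of some `t ^ k`; `G(0) ≠ 0` forces `k = 0`, so `G(v) = G(0)`.
  have key : G * H * (G - C (eval 0 G)) = 0 := by
    refine MvPolynomial.funext fun v => ?_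
    rw [map_mul, map_zero, mul_eq_zero, or_iff_not_imp_left]
    intro hv
    let φ : MvPolynomial σ K →ₐ[K] Polynomial K :=
      MvPolynomial.aeval fun i => Polynomial.C (v i) * Polynomial.X
    have hφ : ∀ (P : MvPolynomial σ K) (t : K), (φ P).eval t = eval (t • v) P := by
      intro P t
      have : ((Polynomial.evalRingHom t).comp (φ : MvPolynomial σ K →+* Polynomial K))
          = eval (t • v) := by
        ext i
        · simp [φ]
        · simp [φ, mul_comm t]
      exact congrArg (fun f => f P) this
    have hGH : φ G * φ H = Polynomial.C (eval v (G * H)) * Polynomial.X ^ d := by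
      refine Polynomial.funext fun t => ?_
      rw [← map_mul, hφ, hF.eval_smul, Polynomial.eval_mul, Polynomial.eval_C, Polynomial.eval_pow,
        Polynomial.eval_X, mul_comm]
    have hdvd : φ G ∣ Polynomial.X ^ d := by
      have : φ G ∣ Polynomial.C (eval v (G * H)) * Polynomial.X ^ d := ⟨_, hGH.symm⟩
      exact ((Polynomial.isUnit_C.2 (IsUnit.mk0 _ hv)).dvd_mul_left).1 this
    obtain ⟨k, -, hk⟩ := (dvd_prime_pow Polynomial.prime_X d).1 hdvd
    have hk0 : k = 0 := by
      by_contra hk0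
      have h1 : Polynomial.X ∣ φ G := (dvd_pow_self _ hk0).trans hk.symm.dvd
      rw [Polynomial.X_dvd_iff, Polynomial.coeff_zero_eq_eval_zero, hφ, zero_smul] at h1
      exact hG0 h1
    rw [hk0, pow_zero, associated_one_iff_isUnit, Polynomial.isUnit_iff] at hk
    obtain ⟨c, -, hc⟩ := hk
    have e1 := hφ G 1
    have e0 := hφ G 0
    rw [← hc, Polynomial.eval_C, one_smul] at e1
    rw [← hc, Polynomial.eval_C, zero_smul] at e0
    rw [map_sub, eval_C, ← e1, ← e0, sub_self]
  rcases mul_eq_zero.1 key with h | h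
  · exact absurd h h0
  · exact sub_eq_zero.1 h

/-- Splitting off one variable, a maximal ideal contracts to a maximal ideal by the Jacobson
property, and the height drops by exactly one. -/
theorem height_eq_of_isMaximal (n : ℕ) (M : Ideal (MvPolynomial (Fin n) K)) (hM : M.IsMaximal) :
    M.height = n := by
  induction n with
  | zero =>
    have hf : IsField (MvPolynomial (Fin 0) K) :=
      (isEmptyAlgEquiv K (Fin 0)).toMulEquiv.isField (Field.toIsField K)
    let := hf.toField
    have : M = ⊥ := (Ideal.eq_bot_or_top M).resolve_right hM.ne_top
    simp [this]
  | succ n ih =>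
    let e := (finSuccEquiv K n).toRingEquiv
    have hM' : (M.map e).IsMaximal := Ideal.map_isMaximal_of_equiv e
    have h1 := e.height_map M
    generalize M.map e = P at hM' h1
    have hP : (P.comap (Polynomial.C : MvPolynomial (Fin n) K →+* _)).IsMaximal :=
      Polynomial.isMaximal_comap_C_of_isJacobsonRing P
    have : P.LiesOver (P.comap (Polynomial.C : MvPolynomial (Fin n) K →+* _)) := ⟨rfl⟩
    rw [← h1, Polynomial.height_eq_height_add_one (P.comap Polynomial.C) P, ih _ hP]
    simp

end General

/-! ### Directional derivatives and linear substitutions -/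

section Directional

variable {K : Type*} [Field K] {σ τ : Type*} [Fintype σ]

/-- The derivative of `F` at `v` in the direction `t`. -/
noncomputable def dirDeriv (v t : σ → K) : MvPolynomial σ K →ₗ[K] K where
  toFun F := ∑ i, t i * eval v (pderiv i F)
  map_add' F G := by simp [mul_add, Finset.sum_add_distrib]
  map_smul' c F := by
    simp only [Derivation.map_smul, smul_eval, RingHom.id_apply, smul_eq_mul, Finset.mul_sum]
    exact Finset.sum_congr rfl fun i _ => by ring

theorem dirDeriv_apply (v t : σ → K) (F : MvPolynomial σ K) :
    dirDeriv v t F = ∑ i, t i * eval v (pderiv i F) := rfl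

theorem dirDeriv_mul (v t : σ → K) (F G : MvPolynomial σ K) :
    dirDeriv v t (F * G) = eval v F * dirDeriv v t G + eval v G * dirDeriv v t F := by
  simp only [dirDeriv_apply, Derivation.leibniz, map_add, smul_eq_mul, map_mul, Finset.mul_sum,
    ← Finset.sum_add_distrib]
  exact Finset.sum_congr rfl fun i _ => by ring

theorem dirDeriv_C (v t : σ → K) (a : K) : dirDeriv v t (C a) = 0 := by
  simp [dirDeriv_apply]

theorem dirDeriv_X (v t : σ → K) (i : σ) : dirDeriv v t (X i) = t i := by
  classical
  simp [dirDeriv_apply, pderiv_X, Pi.single_apply, apply_ite]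

theorem dirDeriv_single [DecidableEq σ] (v : σ → K) (i : σ) (F : MvPolynomial σ K) :
    dirDeriv v (Pi.single i 1) F = eval v (pderiv i F) := by
  simp [dirDeriv_apply, Pi.single_apply]

variable [DecidableEq σ]

/-- The linear form with the same values as the linear functional `f`. -/
noncomputable def linForm (f : (σ → K) →ₗ[K] K) : MvPolynomial σ K :=
  ∑ i, C (f (Pi.single i 1)) * X i

theorem linForm_isHomogeneous (f : (σ → K) →ₗ[K] K) : (linForm f).IsHomogeneous 1 :=
  IsHomogeneous.sum _ _ _ fun _ _ => isHomogeneous_C_mul_X _ _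

theorem apply_eq_sum (f : (σ → K) →ₗ[K] K) (v : σ → K) :
    ∑ i, f (Pi.single i 1) * v i = f v := by
  rw [LinearMap.pi_apply_eq_sum_univ f v]
  refine Finset.sum_congr rfl fun i _ => ?_
  rw [smul_eq_mul, mul_comm]
  congr 2
  ext j
  simp [Pi.single_apply, eq_comm]

@[simp]
theorem eval_linForm (f : (σ → K) →ₗ[K] K) (v : σ → K) : eval v (linForm f) = f v := by
  simp [linForm, apply_eq_sum]

@[simp]
theorem dirDeriv_linForm (f : (σ → K) →ₗ[K] K) (v t : σ → K) :
    dirDeriv v t (linForm f) = f t := by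
  simp [linForm, dirDeriv_mul, dirDeriv_C, dirDeriv_X, apply_eq_sum]

/-- Composition of polynomial functions with a linear map. -/
noncomputable def linSubst (e : (σ → K) →ₗ[K] (τ → K)) :
    MvPolynomial τ K →ₐ[K] MvPolynomial σ K :=
  aeval fun j => linForm (LinearMap.proj j ∘ₗ e)

@[simp]
theorem eval_linSubst (e : (σ → K) →ₗ[K] (τ → K)) (F : MvPolynomial τ K) (v : σ → K) :
    eval v (linSubst e F) = eval (e v) F := by
  have : (eval v).comp (linSubst e : MvPolynomial τ K →+* MvPolynomial σ K) = eval (e v) := by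
    ext i <;> simp [linSubst]
  exact congrArg (fun f => f F) this

theorem IsHomogeneous.linSubst {F : MvPolynomial τ K} {d : ℕ} (hF : F.IsHomogeneous d)
    (e : (σ → K) →ₗ[K] (τ → K)) : (linSubst e F).IsHomogeneous d := by
  have h := IsHomogeneous.aeval (S := K) (n := 1) hF (fun j => linForm (LinearMap.proj j ∘ₗ e))
    (fun j => linForm_isHomogeneous _)
  rw [one_mul] at h
  exact h

/-- The chain rule for composition with a linear map. -/
theorem dirDeriv_linSubst [Fintype τ] (e : (σ → K) →ₗ[K] (τ → K)) (F : MvPolynomial τ K)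
    (v t : σ → K) :
    dirDeriv v t (linSubst e F) = dirDeriv (e v) (e t) F := by
  induction F using MvPolynomial.induction_on with
  | C a => simp [MvPolynomial.linSubst, dirDeriv_C, algebraMap_eq]
  | add p q hp hq => simp [hp, hq]
  | mul_X p i hp =>
    rw [map_mul, dirDeriv_mul, dirDeriv_mul, hp, eval_linSubst, eval_linSubst, dirDeriv_X]
    congr 2
    simp [MvPolynomial.linSubst]

/-- An invertible linear change of coordinates, as an automorphism of the polynomial ring. -/
noncomputable def linSubstEquiv [Infinite K] (e : (σ → K) ≃ₗ[K] (σ → K)) :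
    MvPolynomial σ K ≃ₐ[K] MvPolynomial σ K :=
  AlgEquiv.ofAlgHom (linSubst e.toLinearMap) (linSubst e.symm.toLinearMap)
    (AlgHom.ext fun F => MvPolynomial.funext fun v => by simp)
    (AlgHom.ext fun F => MvPolynomial.funext fun v => by simp)

end Directional

end MvPolynomial

namespace MvPolynomial

/-! ### Dimensions of spaces of forms -/

section Hilbert

variable {K : Type*} [Field K] {σ : Type*}

instance finiteDimensional_homogeneousSubmodule [Finite σ] (k : ℕ) :
    FiniteDimensional K (homogeneousSubmodule σ K k) :=
  Module.Finite.iff_fg.2 (homogeneousSubmodule_fg σ K k)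

theorem finrank_homogeneousSubmodule_fin_three (k : ℕ) :
    Module.finrank K (homogeneousSubmodule (Fin 3) K k) = (k + 2).choose 2 := by
  rw [homogeneousSubmodule_eq_finsupp_supported]
  have e := AddMonoidAlgebra.supportedEquivFinsupp (R := K) (S := K)
    {d : Fin 3 →₀ ℕ | d.degree = k}
  have hs : {d : Fin 3 →₀ ℕ | d.degree = k} =
      ((Finset.univ : Finset (Fin 3)).finsuppAntidiag k : Set (Fin 3 →₀ ℕ)) := by
    ext d
    simp [Finset.mem_finsuppAntidiag, Finsupp.degree_eq_sum]
  have hf : Fintype {d : Fin 3 →₀ ℕ | d.degree = k} := by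
    rw [hs]; infer_instance
  rw [LinearEquiv.finrank_eq e, Module.finrank_finsupp_self, ← Nat.card_eq_fintype_card,
    Nat.card_coe_set_eq, hs, Set.ncard_coe_finset, Finset.card_finsuppAntidiag_nat_eq_choose]
  simp only [Finset.card_univ, Fintype.card_fin]
  rw [show 3 + k - 1 = k + 2 by omega, ← Nat.choose_symm_add]

/-- Multiplication by a form of degree `m`, as a map between spaces of forms. -/
noncomputable def mulForm {A : MvPolynomial σ K} {m : ℕ} (hA : A.IsHomogeneous m) {r s : ℕ}
    (h : m + r = s) : homogeneousSubmodule σ K r →ₗ[K] homogeneousSubmodule σ K s :=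
  (LinearMap.mulLeft K A).restrict fun _ hW => h ▸ hA.mul hW

@[simp]
theorem coe_mulForm {A : MvPolynomial σ K} {m : ℕ} (hA : A.IsHomogeneous m) {r s : ℕ}
    (h : m + r = s) (W : homogeneousSubmodule σ K r) :
    (mulForm hA h W : MvPolynomial σ K) = A * W := rfl

/-- The degree `m + n + r` part of the ideal generated by coprime forms of degrees `m` and `n`
has at least the dimension predicted by the Koszul complex. -/
theorem finrank_range_mulForm_coprod [Finite σ] {A B : MvPolynomial σ K} {m n : ℕ}
    (hA : A.IsHomogeneous m) (hB : B.IsHomogeneous n) (hA0 : A ≠ 0) (hAB : IsRelPrime A B)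
    (r : ℕ) :
    Module.finrank K (homogeneousSubmodule σ K (n + r)) +
      Module.finrank K (homogeneousSubmodule σ K (m + r)) ≤
    Module.finrank K (LinearMap.range (LinearMap.coprod
      (mulForm hA (r := n + r) (s := m + n + r) (by ring))
      (mulForm hB (r := m + r) (by ring)))) +
    Module.finrank K (homogeneousSubmodule σ K r) := by
  set μ := LinearMap.coprod (mulForm hA (r := n + r) (s := m + n + r) (by ring))
      (mulForm hB (r := m + r) (by ring)) with hμ
  have h1 := LinearMap.finrank_range_add_finrank_ker μ
  rw [Module.finrank_prod] at h1
  rw [← h1]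
  gcongr
  -- Coprimality makes every syzygy of `A`, `B` a Koszul syzygy `(-B W, A W)`.
  let κ : homogeneousSubmodule σ K r →ₗ[K]
      homogeneousSubmodule σ K (n + r) × homogeneousSubmodule σ K (m + r) :=
    LinearMap.prod (-mulForm hB rfl) (mulForm hA rfl)
  have hκ : LinearMap.ker μ ≤ LinearMap.range κ := by
    rintro ⟨U, V⟩ h
    have h' : A * (U : MvPolynomial σ K) + B * V = 0 := by
      have := congrArg Subtype.val (LinearMap.mem_ker.1 h)
      simpa [hμ] using this
    have hdvd : A ∣ (V : MvPolynomial σ K) :=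
      hAB.dvd_of_dvd_mul_left ⟨-U, by linear_combination h'⟩
    obtain ⟨W, hW⟩ := hdvd
    have hWr : W.IsHomogeneous r := hA.of_mul_left hA0 (hW ▸ V.2)
    refine ⟨⟨W, hWr⟩, Prod.ext (Subtype.ext ?_) (Subtype.ext ?_)⟩
    · have : A * (-(B * W)) = A * U := by
        rw [hW] at h'
        linear_combination -h'
      simpa [κ] using mul_left_cancel₀ hA0 this
    · simpa [κ] using hW.symm
  exact (Submodule.finrank_mono hκ).trans (LinearMap.finrank_range_le κ)

end Hilbert

/-! ### Interpolation at points with tangent directions, and Bézout -/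

section Interpolation

variable {K : Type*} [Field K] {σ : Type*} [Fintype σ]

theorem dirDeriv_sq_mul_eq_zero {q : σ → K} {l : MvPolynomial σ K} (hl : eval q l = 0)
    (t : σ → K) (Z : MvPolynomial σ K) : dirDeriv q t (l ^ 2 * Z) = 0 := by
  simp [dirDeriv_mul, sq, hl]

variable [DecidableEq σ]

theorem exists_linForm_of_notMem_span {u v : σ → K} (h : u ∉ Submodule.span K {v}) :
    ∃ l : MvPolynomial σ K, l.IsHomogeneous 1 ∧ eval v l = 0 ∧ eval u l ≠ 0 ∧
      ∀ w, dirDeriv w u l ≠ 0 := by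
  obtain ⟨f, hf, hf'⟩ := Submodule.exists_dual_map_eq_bot_of_notMem h inferInstance
  refine ⟨linForm f, linForm_isHomogeneous f, ?_, by simpa using hf, fun w => by simpa using hf⟩
  rw [eval_linForm]
  have : f v ∈ (Submodule.span K {v}).map f :=
    Submodule.mem_map_of_mem (Submodule.mem_span_singleton_self v)
  rwa [hf', Submodule.mem_bot] at this

/-- Values and one derivative at finitely many points of projective space can be prescribed
by forms of large degree. -/
theorem exists_form_eval_dirDeriv {ι : Type*} [Fintype ι] {q t : ι → σ → K}
    (hq : ∀ i, q i ≠ 0) (hqq : ∀ i j, i ≠ j → q i ∉ Submodule.span K {q j})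
    (ht : ∀ i, t i ∉ Submodule.span K {q i}) (s : ℕ) (a b : ι → K) :
    ∃ G : MvPolynomial σ K, G.IsHomogeneous (2 * Fintype.card ι + s) ∧
      ∀ i, eval (q i) G = a i ∧ dirDeriv (q i) (t i) G = b i := by
  classical
  have hl : ∀ i j, ∃ l : MvPolynomial σ K, l.IsHomogeneous 1 ∧
      (i ≠ j → eval (q j) l = 0 ∧ eval (q i) l ≠ 0) := by
    intro i j
    by_cases hij : i = j
    · exact ⟨0, isHomogeneous_zero _ _ _, fun h => absurd hij h⟩
    · obtain ⟨l, h1, h2, h3, -⟩ := exists_linForm_of_notMem_span (hqq i j hij)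
      exact ⟨l, h1, fun _ => ⟨h2, h3⟩⟩
  choose l hl1 hl2 using hl
  have hu : ∀ i, ∃ u : MvPolynomial σ K, u.IsHomogeneous 1 ∧ eval (q i) u ≠ 0 := by
    intro i
    obtain ⟨u, h1, -, h3, -⟩ := exists_linForm_of_notMem_span (u := q i) (v := (0 : σ → K))
      (by simpa using hq i)
    exact ⟨u, h1, h3⟩
  choose u hu1 hu2 using hu
  have hc : ∀ i, ∃ c : MvPolynomial σ K, c.IsHomogeneous 1 ∧ eval (q i) c = 0 ∧
      dirDeriv (q i) (t i) c ≠ 0 := by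
    intro i
    obtain ⟨c, h1, h2, -, h4⟩ := exists_linForm_of_notMem_span (ht i)
    exact ⟨c, h1, h2, h4 _⟩
  choose c hc1 hc2 hc3 using hc
  -- The squares make every multiple of `R i` vanish to second order at the other points.
  let R : ι → MvPolynomial σ K := fun i => ∏ j ∈ Finset.univ.erase i, l i j ^ 2
  have hR : ∀ i, (R i).IsHomogeneous (2 * (Fintype.card ι - 1)) := by
    intro i
    have := IsHomogeneous.prod (Finset.univ.erase i) (fun j => l i j ^ 2) (fun _ => 1 * 2)
      fun j _ => (hl1 i j).pow 2
    rw [Finset.sum_const, Finset.card_erase_of_mem (Finset.mem_univ i), Finset.card_univ,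
      smul_eq_mul, one_mul, mul_comm] at this
    exact this
  have hRi : ∀ i, eval (q i) (R i) ≠ 0 := by
    intro i
    simp only [R, map_prod, map_pow]
    exact Finset.prod_ne_zero_iff.2 fun j hj =>
      pow_ne_zero _ (hl2 i j (Finset.ne_of_mem_erase hj).symm).2
  have hRj : ∀ i j, i ≠ j → ∀ Z, eval (q j) (R i * Z) = 0 ∧ dirDeriv (q j) (t j) (R i * Z) = 0 := by
    intro i j hij Z
    have hmem : j ∈ Finset.univ.erase i := Finset.mem_erase.2 ⟨hij.symm, Finset.mem_univ j⟩
    simp only [R]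
    rw [← Finset.mul_prod_erase _ _ hmem, mul_assoc]
    exact ⟨by simp [(hl2 i j hij).1], dirDeriv_sq_mul_eq_zero (hl2 i j hij).1 _ _⟩
  -- At `q i`, `P i` adjusts the value; `Q i` vanishes there and then adjusts the derivative. The
  -- powers of `u i` fill up the degree.
  let P : ι → MvPolynomial σ K := fun i => R i * u i ^ (s + 2)
  let Q : ι → MvPolynomial σ K := fun i => R i * (c i * u i ^ (s + 1))
  have hdeg : ∀ i : ι, 2 * (Fintype.card ι - 1) + (s + 2) = 2 * Fintype.card ι + s := by
    intro i
    have : 0 < Fintype.card ι := Fintype.card_pos_iff.2 ⟨i⟩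
    omega
  have hP : ∀ i, (P i).IsHomogeneous (2 * Fintype.card ι + s) := by
    intro i
    rw [← hdeg i]
    refine (hR i).mul ?_
    simpa using (hu1 i).pow (s + 2)
  have hQ : ∀ i, (Q i).IsHomogeneous (2 * Fintype.card ι + s) := by
    intro i
    rw [← hdeg i]
    refine (hR i).mul ?_
    have := (hc1 i).mul ((hu1 i).pow (s + 1))
    rwa [show 1 + 1 * (s + 1) = s + 2 by ring] at this
  have hPi : ∀ i, eval (q i) (P i) ≠ 0 := fun i => by
    simpa [P] using ⟨hRi i, fun h => absurd h (hu2 i)⟩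
  have hQi : ∀ i, eval (q i) (Q i) = 0 := fun i => by simp [Q, hc2]
  have hQi' : ∀ i, dirDeriv (q i) (t i) (Q i) ≠ 0 := fun i => by
    simp only [Q, dirDeriv_mul, map_mul, map_pow, hc2]
    simpa using ⟨hRi i, fun h => absurd h (hu2 i), hc3 i⟩
  let α : ι → K := fun i => a i / eval (q i) (P i)
  let β : ι → K := fun i =>
    (b i - α i * dirDeriv (q i) (t i) (P i)) / dirDeriv (q i) (t i) (Q i)
  refine ⟨∑ i, (α i • P i + β i • Q i), ?_, fun j => ⟨?_, ?_⟩⟩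
  · refine IsHomogeneous.sum _ _ _ fun i _ => ?_
    exact ((homogeneousSubmodule σ K _).smul_mem _ (hP i)).add
      ((homogeneousSubmodule σ K _).smul_mem _ (hQ i))
  · rw [map_sum, Finset.sum_eq_single j]
    · simp [hQi, α, hPi]
    · intro i _ hij
      simp only [map_add, smul_eval, P, Q, (hRj i j hij _).1]
      simp
    · simp
  · rw [map_sum, Finset.sum_eq_single j]
    · simp only [map_add, map_smul, smul_eq_mul]
      rw [show β j = (b j - α j * dirDeriv (q j) (t j) (P j)) / dirDeriv (q j) (t j) (Q j) from rfl,
        div_mul_cancel₀ _ (hQi' j)]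
      ring
    · intro i _ hij
      simp only [map_add, map_smul, P, Q, (hRj i j hij _).2]
      simp
    · simp

end Interpolation

/-- A weak form of Bézout's theorem for coprime plane curves of degrees `m` and `n`: there are at
most `m * n / 2` points at which both curves pass in a common tangent direction. -/
theorem two_mul_card_le_of_tangent {K : Type*} [Field K] {A B : MvPolynomial (Fin 3) K} {m n : ℕ}
    (hA : A.IsHomogeneous m) (hB : B.IsHomogeneous n) (hA0 : A ≠ 0) (hAB : IsRelPrime A B)
    {ι : Type*} [Fintype ι] {q t : ι → Fin 3 → K}
    (hq : ∀ i, q i ≠ 0) (hqq : ∀ i j, i ≠ j → q i ∉ Submodule.span K {q j})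
    (ht : ∀ i, t i ∉ Submodule.span K {q i})
    (hAq : ∀ i, eval (q i) A = 0) (hBq : ∀ i, eval (q i) B = 0)
    (hAt : ∀ i, dirDeriv (q i) (t i) A = 0) (hBt : ∀ i, dirDeriv (q i) (t i) B = 0) :
    2 * Fintype.card ι ≤ m * n := by
  -- Large enough for interpolation in degree `m + n + r`.
  let r := 2 * Fintype.card ι
  let S := homogeneousSubmodule (Fin 3) K (m + n + r)
  have h1 := finrank_range_mulForm_coprod hA hB hA0 hAB r
  set μ := LinearMap.coprod (mulForm hA (r := n + r) (s := m + n + r) (by ring))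
      (mulForm hB (r := m + r) (by ring)) with hμ
  let Λ : S →ₗ[K] ι → K × K :=
    (LinearMap.pi fun i => (aeval (q i)).toLinearMap.prod (dirDeriv (q i) (t i))) ∘ₗ S.subtype
  have hΛ : LinearMap.range Λ = ⊤ := by
    rw [LinearMap.range_eq_top]
    intro y
    obtain ⟨G, hG, hG'⟩ := exists_form_eval_dirDeriv hq hqq ht (m + n) (fun i => (y i).1)
      fun i => (y i).2
    rw [show 2 * Fintype.card ι + (m + n) = m + n + r by ring] at hG
    refine ⟨⟨G, hG⟩, ?_⟩
    funext i
    exact Prod.ext (hG' i).1 (hG' i).2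
  have hle : LinearMap.range μ ≤ LinearMap.ker Λ := by
    rintro _ ⟨⟨U, V⟩, rfl⟩
    rw [LinearMap.mem_ker]
    funext i
    refine Prod.ext ?_ ?_
    · simp [Λ, S, hμ, aeval_eq_eval, hAq, hBq]
    · simp [Λ, S, hμ, dirDeriv_mul, hAq, hBq, hAt, hBt]
  have h2 := LinearMap.finrank_range_add_finrank_ker Λ
  have h3 := Submodule.finrank_mono hle
  rw [hΛ, finrank_top, Module.finrank_pi_fintype] at h2
  simp only [Module.finrank_prod, Module.finrank_self, Finset.sum_const, Finset.card_univ,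
    smul_eq_mul, S] at h2
  rw [finrank_homogeneousSubmodule_fin_three] at h2
  simp only [finrank_homogeneousSubmodule_fin_three] at h1
  have hch : ∀ k : ℕ, (k + 2).choose 2 * 2 = (k + 2) * (k + 1) := by
    intro k
    rw [Nat.choose_two_right, Nat.div_mul_cancel]
    · rfl
    · exact (Nat.even_mul_pred_self _).two_dvd
  have e1 := hch (m + n + r)
  have e2 := hch (n + r)
  have e3 := hch (m + r)
  have e4 := hch r
  -- The alternating sum of the four binomial coefficients is `m * n`.
  nlinarith
end MvPolynomial

/-! ### Singular points of monoids -/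

section Surfaces

variable {K : Type*} [Field K]

theorem mk_mem_singLocus_iff {F : MvPolynomial (Fin 4) K} {d : ℕ} (hF : F.IsHomogeneous d)
    {v : Fin 4 → K} (hv : v ≠ 0) :
    Projectivization.mk K v hv ∈ singLocus F ↔ eval v F = 0 ∧ ∀ t, dirDeriv v t F = 0 := by
  obtain ⟨a, ha⟩ := Projectivization.exists_smul_eq_mk_rep K v hv
  have h1 : ∀ (P : MvPolynomial (Fin 4) K) (k : ℕ), P.IsHomogeneous k →
      (eval (Projectivization.mk K v hv).rep P = 0 ↔ eval v P = 0) := by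
    intro P k hP
    rw [← ha, Units.smul_def, hP.eval_smul]
    simp
  simp only [singLocus, Set.mem_ofPred_eq]
  rw [h1 F d hF]
  refine and_congr_right fun _ => ⟨fun h t => ?_, fun h i => ?_⟩
  · rw [dirDeriv_apply]
    exact Finset.sum_eq_zero fun i _ => by rw [(h1 _ _ hF.pderiv).1 (h i), mul_zero]
  · rw [h1 _ _ hF.pderiv, ← dirDeriv_single, h]

theorem mem_singLocus_iff {F : MvPolynomial (Fin 4) K} {d : ℕ} (hF : F.IsHomogeneous d)
    {p : P3 K} : p ∈ singLocus F ↔ eval p.rep F = 0 ∧ ∀ t, dirDeriv p.rep t F = 0 := by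
  conv_lhs => rw [← p.mk_rep]
  exact mk_mem_singLocus_iff hF p.rep_nonzero

theorem image_singLocus_linSubst {F : MvPolynomial (Fin 4) K} {d : ℕ} (hF : F.IsHomogeneous d)
    (e : (Fin 4 → K) ≃ₗ[K] (Fin 4 → K)) :
    Projectivization.map e.toLinearMap e.injective '' singLocus (linSubst e.toLinearMap F) =
      singLocus F := by
  ext p
  constructor
  · rintro ⟨p, hp, rfl⟩
    induction p using Projectivization.ind with
    | h v hv =>
      rw [mk_mem_singLocus_iff (hF.linSubst _)] at hp
      rw [Projectivization.map_mk, mk_mem_singLocus_iff hF]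
      simp only [eval_linSubst, dirDeriv_linSubst] at hp
      exact ⟨hp.1, fun t => by simpa using hp.2 (e.symm t)⟩
  · induction p using Projectivization.ind with
    | h v hv =>
      intro hp
      rw [mk_mem_singLocus_iff hF] at hp
      refine ⟨Projectivization.mk K (e.symm v) (by simpa using hv), ?_, ?_⟩
      · rw [mk_mem_singLocus_iff (hF.linSubst _)]
        simp only [eval_linSubst, dirDeriv_linSubst]
        simpa using ⟨hp.1, fun t => hp.2 (e t)⟩
      · simp [Projectivization.map_mk]

/-- The projection `(w, q) ↦ q`. -/
def tailMap (K : Type*) [Field K] : (Fin 4 → K) →ₗ[K] (Fin 3 → K) := LinearMap.funLeft K K Fin.succ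

/-- The inclusion `q ↦ (0, q)`. -/
def consZeroMap (K : Type*) [Field K] : (Fin 3 → K) →ₗ[K] (Fin 4 → K) where
  toFun q := Fin.cons 0 q
  map_add' p q := by ext i; refine Fin.cases ?_ (fun j => ?_) i <;> simp
  map_smul' c q := by ext i; refine Fin.cases ?_ (fun j => ?_) i <;> simp

@[simp]
theorem tailMap_cons (w : K) (q : Fin 3 → K) : tailMap K (Fin.cons w q) = q := rfl

theorem cons_tailMap (v : Fin 4 → K) : Fin.cons (v 0) (tailMap K v) = v := Fin.cons_self_tail v

theorem consZeroMap_apply (q : Fin 3 → K) : consZeroMap K q = Fin.cons 0 q := rfl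

@[simp]
theorem tailMap_consZeroMap (q : Fin 3 → K) : tailMap K (consZeroMap K q) = q := rfl

/-- The equation `x₀ A + B` of a monoid with vertex `(1 : 0 : 0 : 0)`. -/
noncomputable def monoidForm (A B : MvPolynomial (Fin 3) K) : MvPolynomial (Fin 4) K :=
  X 0 * linSubst (tailMap K) A + linSubst (tailMap K) B

theorem eval_monoidForm (A B : MvPolynomial (Fin 3) K) (v : Fin 4 → K) :
    eval v (monoidForm A B) = v 0 * eval (tailMap K v) A + eval (tailMap K v) B := by
  simp [monoidForm]

theorem dirDeriv_monoidForm (A B : MvPolynomial (Fin 3) K) (v t : Fin 4 → K) :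
    dirDeriv v t (monoidForm A B) =
      v 0 * dirDeriv (tailMap K v) (tailMap K t) A + eval (tailMap K v) A * t 0 +
        dirDeriv (tailMap K v) (tailMap K t) B := by
  simp [monoidForm, dirDeriv_mul, dirDeriv_linSubst, dirDeriv_X]

theorem monoidForm_isHomogeneous {A B : MvPolynomial (Fin 3) K} {m : ℕ} (hA : A.IsHomogeneous m)
    (hB : B.IsHomogeneous (m + 1)) : (monoidForm A B).IsHomogeneous (m + 1) := by
  rw [add_comm m 1] at hB ⊢
  exact ((isHomogeneous_X K 0).mul (hA.linSubst _)).add (hB.linSubst _)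

/-- The derivative along `x₀` is `A`; once it vanishes, the equation reduces to `B` and the other
derivatives to those of `v 0 * A + B`. -/
theorem singular_monoidForm_iff (A B : MvPolynomial (Fin 3) K) (v : Fin 4 → K) :
    (eval v (monoidForm A B) = 0 ∧ ∀ t, dirDeriv v t (monoidForm A B) = 0) ↔
      eval (tailMap K v) A = 0 ∧ eval (tailMap K v) B = 0 ∧
        ∀ s, v 0 * dirDeriv (tailMap K v) s A + dirDeriv (tailMap K v) s B = 0 := by
  rw [eval_monoidForm]
  simp only [dirDeriv_monoidForm]
  constructor
  · rintro ⟨h1, h2⟩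
    have hA : eval (tailMap K v) A = 0 := by
      have h := h2 (Fin.cons 1 0)
      rw [tailMap_cons] at h
      simpa [dirDeriv_apply] using h
    refine ⟨hA, by simpa [hA] using h1, fun s => ?_⟩
    simpa [hA] using h2 (Fin.cons 0 s)
  · rintro ⟨hA, hB, h⟩
    exact ⟨by simp [hA, hB], fun t => by simpa [hA] using h (tailMap K t)⟩

/-- The kernel has dimension at least 2, so no line contains it. -/
theorem exists_notMem_span_apply_eq_zero (f : (Fin 3 → K) →ₗ[K] K) (q : Fin 3 → K) :
    ∃ t, t ∉ Submodule.span K {q} ∧ f t = 0 := by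
  by_contra! h
  have hle : LinearMap.ker f ≤ Submodule.span K {q} := fun t ht => by
    by_contra hn
    exact h t hn ht
  have h1 : Module.finrank K (LinearMap.ker f) ≤ 1 :=
    (Submodule.finrank_mono hle).trans (by simpa using finrank_span_le_card (R := K) {q})
  have h2 := LinearMap.finrank_range_add_finrank_ker f
  have h3 := (Submodule.finrank_le (LinearMap.range f))
  simp only [Module.finrank_fin_fun, Module.finrank_self] at h2 h3
  omega

theorem exists_tangent (A : MvPolynomial (Fin 3) K) (q : Fin 3 → K) :
    ∃ t, t ∉ Submodule.span K {q} ∧ dirDeriv q t A = 0 := by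
  obtain ⟨t, h1, h2⟩ := exists_notMem_span_apply_eq_zero
    (Fintype.linearCombination K fun i => eval q (pderiv i A)) q
  exact ⟨t, h1, by simpa [dirDeriv_apply, Fintype.linearCombination_apply] using h2⟩

/-- If the cones `A` and `B` are both singular along a line through the vertex, then so is the
monoid. -/
theorem infinite_singLocus_monoidForm [Infinite K] {A B : MvPolynomial (Fin 3) K} {m : ℕ}
    (hA : A.IsHomogeneous m) (hB : B.IsHomogeneous (m + 1)) {q : Fin 3 → K} (hq : q ≠ 0)
    (hAq : eval q A = 0) (hBq : eval q B = 0) (hAt : ∀ s, dirDeriv q s A = 0)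
    (hBt : ∀ s, dirDeriv q s B = 0) : (singLocus (monoidForm A B)).Infinite := by
  have hne : ∀ w : K, (Fin.cons w q : Fin 4 → K) ≠ 0 := fun w h =>
    hq (by simpa using congrArg (tailMap K) h)
  refine Set.infinite_of_injective_forall_mem
    (f := fun w : K => Projectivization.mk K (Fin.cons w q : Fin 4 → K) (hne w)) ?_ fun w => ?_
  · intro w w' h
    obtain ⟨a, ha⟩ := (Projectivization.mk_eq_mk_iff' K _ _ _ _).1 h
    have h1 : a • q = q := by simpa using congrArg (tailMap K) ha
    have ha1 : a = 1 := by
      have : (a - 1) • q = 0 := by rw [sub_smul, one_smul, h1, sub_self]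
      exact sub_eq_zero.1 ((smul_eq_zero.1 this).resolve_right hq)
    have h0 := congrFun ha 0
    simp [ha1] at h0
    exact h0.symm
  · rw [mk_mem_singLocus_iff (monoidForm_isHomogeneous hA hB), singular_monoidForm_iff]
    simp [hAq, hBq, hAt, hBt]

theorem ncard_singLocus_monoidForm_le [Infinite K] {A B : MvPolynomial (Fin 3) K} {m : ℕ}
    (hA : A.IsHomogeneous m) (hB : B.IsHomogeneous (m + 1)) (hA0 : A ≠ 0) (hAB : IsRelPrime A B)
    (hfin : (singLocus (monoidForm A B)).Finite) :
    (singLocus (monoidForm A B)).ncard ≤ 1 + (m + 1) * m / 2 := by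
  have hF := monoidForm_isHomogeneous hA hB
  have h0 : (Pi.single 0 1 : Fin 4 → K) ≠ 0 := by simp
  set p₀ : P3 K := Projectivization.mk K (Pi.single 0 1) h0 with hp₀
  set S := singLocus (monoidForm A B) \ {p₀} with hS
  have hSfin : S.Finite := hfin.subset Set.sdiff_subset
  have : Fintype S := hSfin.fintype
  have hsing : ∀ i : S, eval (tailMap K i.1.rep) A = 0 ∧ eval (tailMap K i.1.rep) B = 0 ∧
      ∀ s, i.1.rep 0 * dirDeriv (tailMap K i.1.rep) s A + dirDeriv (tailMap K i.1.rep) s B = 0 :=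
    fun i => (singular_monoidForm_iff A B _).1 ((mem_singLocus_iff hF).1 i.2.1)
  have hq : ∀ i : S, tailMap K i.1.rep ≠ 0 := by
    intro i h
    refine i.2.2 ?_
    rw [Set.mem_singleton_iff, ← i.1.mk_rep, hp₀, Projectivization.mk_eq_mk_iff']
    refine ⟨i.1.rep 0, ?_⟩
    rw [← cons_tailMap i.1.rep, h]
    ext j
    refine Fin.cases ?_ (fun j => ?_) j <;> simp
  choose t ht ht' using fun i : S => exists_tangent A (tailMap K i.1.rep)
  have hcard : 2 * Fintype.card S ≤ m * (m + 1) := by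
    refine two_mul_card_le_of_tangent hA hB hA0 hAB hq ?_ ht (fun i => (hsing i).1)
      (fun i => (hsing i).2.1) ht' fun i => by simpa [ht' i] using (hsing i).2.2 (t i)
    intro i j hij hmem
    obtain ⟨c, hc⟩ := Submodule.mem_span_singleton.1 hmem
    have hc0 : c ≠ 0 := by
      rintro rfl
      exact hq i (by rw [← hc, zero_smul])
    have hu : c • j.1.rep ≠ 0 := smul_ne_zero hc0 j.1.rep_nonzero
    have hj : Projectivization.mk K (c • j.1.rep) hu = j.1 := by
      conv_rhs => rw [← j.1.mk_rep]
      exact (Projectivization.mk_eq_mk_iff' K _ _ _ _).2 ⟨c, rfl⟩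
    have htail : tailMap K (c • j.1.rep) = tailMap K i.1.rep := by rw [map_smul, hc]
    have h2 := (mk_mem_singLocus_iff hF hu).1 (hj.symm ▸ j.2.1 :)
    rw [singular_monoidForm_iff, htail] at h2
    have h1 := hsing i
    -- Subtracting the gradient relations of two points over the same `q` isolates `dA`, multiplied
    -- by the difference of their `x₀`-coordinates.
    have hne : i.1.rep 0 ≠ (c • j.1.rep) 0 := by
      intro h
      have hv : i.1.rep = c • j.1.rep := by
        rw [← cons_tailMap i.1.rep, ← cons_tailMap (c • j.1.rep), htail, h]
      refine hij (Subtype.ext ?_)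
      rw [← hj, ← i.1.mk_rep]
      exact (Projectivization.mk_eq_mk_iff' K _ _ _ _).2 ⟨1, by rw [one_smul, hv]⟩
    have hAt : ∀ s, dirDeriv (tailMap K i.1.rep) s A = 0 := fun s => by
      have : (i.1.rep 0 - (c • j.1.rep) 0) * dirDeriv (tailMap K i.1.rep) s A = 0 := by
        linear_combination h1.2.2 s - h2.2.2 s
      exact (mul_eq_zero.1 this).resolve_left (sub_ne_zero.2 hne)
    exact infinite_singLocus_monoidForm hA hB (hq i) h1.1 h1.2.1 hAt
      (fun s => by simpa [hAt s] using h1.2.2 s) hfin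
  rw [← Nat.card_eq_fintype_card, Nat.card_coe_set_eq] at hcard
  have h1 : (singLocus (monoidForm A B)).ncard ≤ S.ncard + 1 :=
    Nat.sub_le_iff_le_add.1 (Set.pred_ncard_le_ncard_sdiff_singleton _ _)
  have h2 : S.ncard ≤ (m + 1) * m / 2 := by
    rw [Nat.le_div_iff_mul_le two_pos]
    linarith
  omega

end Surfaces

/-! ### Reduction to a monoid -/

section NormalForm

variable {K : Type*} [Field K]

theorem exists_linearEquiv_apply_eq {V : Type*} [AddCommGroup V] [Module K V] {u v : V}
    (hu : u ≠ 0) (hv : v ≠ 0) : ∃ e : V ≃ₗ[K] V, e u = v := by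
  let f := (LinearEquiv.toSpanNonzeroSingleton K V u hu).symm ≪≫ₗ
    LinearEquiv.toSpanNonzeroSingleton K V v hv
  obtain ⟨e, he⟩ := Submodule.exists_linearEquiv_restrict_eq f
  refine ⟨e, ?_⟩
  have h := he (LinearEquiv.toSpanNonzeroSingleton K V u hu 1)
  simp only [f, LinearEquiv.trans_apply, LinearEquiv.symm_apply_apply] at h
  simpa using h.symm

/-- The Taylor expansion of a form of degree `m + 1` at a point of multiplicity `m`. -/
theorem exists_taylor_of_orderAt_eq {F : MvPolynomial (Fin 4) K} {m : ℕ}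
    (hF : F.IsHomogeneous (m + 1)) {v : Fin 4 → K} (hord : orderAt F v = m) :
    ∃ G H : MvPolynomial (Fin 4) K, G.IsHomogeneous m ∧ H.IsHomogeneous (m + 1) ∧ G ≠ 0 ∧
      ∀ y, eval (v + y) F = eval y G + eval y H := by
  set T : MvPolynomial (Fin 4) K := aeval (fun i => C (v i) + X i) F with hT
  have hord' : MvPowerSeries.order (T : MvPowerSeries (Fin 4) K) = m := hord
  have hTdeg : T.totalDegree ≤ m + 1 := by
    refine (totalDegree_aeval_le fun i => ?_).trans hF.totalDegree_le
    exact (totalDegree_add _ _).trans (by simp)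
  have hlow : ∀ d : Fin 4 →₀ ℕ, d.degree < m → coeff d T = 0 := fun d hd => by
    rw [← MvPolynomial.coeff_coe]
    exact MvPowerSeries.coeff_of_lt_order (by rw [hord']; exact_mod_cast hd)
  -- The order removes degrees below `m`, the total degree those above `m + 1`.
  have hsum : T = homogeneousComponent m T + homogeneousComponent (m + 1) T := by
    ext d
    rw [coeff_add, coeff_homogeneousComponent, coeff_homogeneousComponent]
    rcases lt_trichotomy d.degree m with h | h | h
    · rw [hlow d h]; simp
    · simp [h]
    · rcases (Nat.succ_le_of_lt h).eq_or_lt with h' | h'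
      · simp [← h']
      · rw [coeff_eq_zero_of_totalDegree_lt]
        · simp
        · exact hTdeg.trans_lt h'
  refine ⟨_, _, homogeneousComponent_isHomogeneous m T, homogeneousComponent_isHomogeneous _ T,
    ?_, fun y => ?_⟩
  · obtain ⟨d, hd, hd'⟩ := MvPowerSeries.exists_coeff_ne_zero_and_order
      (f := (T : MvPowerSeries (Fin 4) K)) (by rw [hord']; rfl)
    rw [hord'] at hd'
    intro h
    apply hd
    rw [MvPolynomial.coeff_coe]
    have h2 := congrArg (coeff d) h
    rw [coeff_homogeneousComponent, if_pos (by exact_mod_cast hd'), coeff_zero] at h2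
    exact h2
  · rw [← map_add, ← hsum]
    have : eval (v + y) = (eval y).comp
        (aeval (fun i => C (v i) + X i) :
          MvPolynomial (Fin 4) K →ₐ[K] MvPolynomial (Fin 4) K).toRingHom := by
      ext i <;> simp
    rw [this]
    rfl

/-- A surface of degree `m + 1` with a point of multiplicity `m` is a monoid, up to a linear change
of coordinates. -/
theorem exists_linSubst_eq_monoidForm [Infinite K] {F : MvPolynomial (Fin 4) K} {m : ℕ}
    (hF : F.IsHomogeneous (m + 1)) {v : Fin 4 → K} (hv : v ≠ 0) (hord : orderAt F v = m) :
    ∃ (e : (Fin 4 → K) ≃ₗ[K] (Fin 4 → K)) (A B : MvPolynomial (Fin 3) K), A.IsHomogeneous m ∧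
      B.IsHomogeneous (m + 1) ∧ A ≠ 0 ∧ linSubst e.toLinearMap F = monoidForm A B := by
  obtain ⟨G, H, hG, hH, hG0, hT⟩ := exists_taylor_of_orderAt_eq hF hord
  obtain ⟨e, he⟩ := exists_linearEquiv_apply_eq (K := K) (u := (Pi.single 0 1 : Fin 4 → K))
    (by simp) hv
  let A := linSubst (e.toLinearMap ∘ₗ consZeroMap K) G
  let B := linSubst (e.toLinearMap ∘ₗ consZeroMap K) H
  have hA : A.IsHomogeneous m := hG.linSubst _
  have hB : B.IsHomogeneous (m + 1) := hH.linSubst _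
  have hFe : ∀ y, eval (Pi.single 0 1 + y) (linSubst e.toLinearMap F) =
      eval (e y) G + eval (e y) H := by
    intro y
    rw [eval_linSubst, ← hT]
    simp [he]
  -- The factor `X 0` confines the comparison to `y 0 ≠ 0`, where `y` rescales to the vertex plus a
  -- vector with zero first coordinate and the Taylor expansion applies.
  have heq : linSubst e.toLinearMap F = monoidForm A B := by
    refine mul_left_cancel₀ (X_ne_zero (R := K) (0 : Fin 4)) (MvPolynomial.funext fun y => ?_)
    simp only [map_mul, eval_X, eval_monoidForm]
    by_cases hy : y 0 = 0
    · simp [hy]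
    congr 1
    have h1 : y = y 0 • (Pi.single 0 1 + consZeroMap K ((y 0)⁻¹ • tailMap K y)) := by
      ext i
      refine Fin.cases ?_ (fun j => ?_) i
      · simp [consZeroMap_apply]
      · simp [consZeroMap_apply, hy, tailMap, LinearMap.funLeft_apply]
    conv_lhs => rw [h1]
    rw [(hF.linSubst _).eval_smul, hFe]
    have h2 : ∀ P : MvPolynomial (Fin 4) K,
        eval (e (consZeroMap K ((y 0)⁻¹ • tailMap K y))) P =
          eval ((y 0)⁻¹ • tailMap K y) (linSubst (e.toLinearMap ∘ₗ consZeroMap K) P) := by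
      intro P
      simp
    rw [h2, h2, hA.eval_smul, hB.eval_smul, inv_pow, inv_pow, pow_succ]
    field_simp
  refine ⟨e, A, B, hA, hB, fun h0 => hG0 ?_, heq⟩
  -- If `A = 0`, this makes `G`, in the new coordinates, homogeneous of degrees `m` and `m + 1` at
  -- once, hence zero.
  have h3 : linSubst e.toLinearMap G = linSubst (tailMap K) B - linSubst e.toLinearMap H := by
    refine MvPolynomial.funext fun y => ?_
    have h4 := hFe y
    rw [heq, h0, eval_monoidForm] at h4
    have h5 : tailMap K (Pi.single 0 1 + y) = tailMap K y := by
      ext i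
      simp [tailMap, LinearMap.funLeft_apply]
    rw [h5] at h4
    simp only [map_zero, mul_zero, zero_add] at h4
    simp [h4]
  have h6 : linSubst e.toLinearMap G = 0 := by
    by_contra hne
    have h7 : (linSubst e.toLinearMap G).IsHomogeneous (m + 1) := by
      rw [h3]
      exact (hB.linSubst (tailMap K)).sub (hH.linSubst e.toLinearMap)
    have := (hG.linSubst e.toLinearMap).inj_right h7 hne
    omega
  exact (linSubstEquiv e).injective (h6.trans (map_zero (linSubstEquiv e)).symm)

/-- A common factor of `A` and `B` divides the monoid form. The cofactor is not constant: its
derivative along `x₀` is the cofactor of `A`, which is nonzero. -/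
theorem isRelPrime_of_irreducible_monoidForm [Infinite K] {A B : MvPolynomial (Fin 3) K}
    (hA0 : A ≠ 0) (hirr : Irreducible (monoidForm A B)) : IsRelPrime A B := by
  rintro g ⟨A', rfl⟩ ⟨B', rfl⟩
  have hfac : monoidForm (g * A') (g * B') = linSubst (tailMap K) g * monoidForm A' B' := by
    simp only [monoidForm, map_mul]
    ring
  rcases hirr.isUnit_or_isUnit hfac with h | h
  · have h1 : linSubst (consZeroMap K) (linSubst (tailMap K) g) = g :=
      MvPolynomial.funext fun q => by simp
    exact h1 ▸ h.map (linSubst (consZeroMap K))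
  · exfalso
    obtain ⟨c, -, hc⟩ := MvPolynomial.isUnit_iff_eq_C_of_isReduced.1 h
    refine hA0 ?_
    have : A' = 0 := MvPolynomial.funext fun q => by
      have h2 := dirDeriv_monoidForm A' B' (Fin.cons 0 q) (Fin.cons 1 0)
      rw [hc, dirDeriv_C, tailMap_cons, tailMap_cons] at h2
      simpa [dirDeriv_apply] using h2.symm
    rw [this, mul_zero]

theorem ncard_singLocus_le_of_isNormalSurface [Infinite K] {F : MvPolynomial (Fin 4) K} {m : ℕ}
    (hF : F.IsHomogeneous (m + 1)) (hN : IsNormalSurface F) {p : P3 K}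
    (hp : multiplicityAt F p = m) : (singLocus F).ncard ≤ 1 + (m + 1) * m / 2 := by
  obtain ⟨e, A, B, hA, hB, hA0, heq⟩ := exists_linSubst_eq_monoidForm hF p.rep_nonzero hp
  have him := image_singLocus_linSubst hF e
  have hinj := Projectivization.map_injective e.toLinearMap e.injective
  rw [heq] at him
  have hirr : Irreducible (monoidForm A B) := by
    rw [← heq]
    exact (MulEquiv.irreducible_iff (linSubstEquiv e)).2 hN.1
  have hfin : (singLocus (monoidForm A B)).Finite := by
    refine Set.Finite.of_finite_image ?_ hinj.injOn
    rw [him]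
    exact hN.2
  rw [← him, Set.ncard_image_of_injective _ hinj]
  exact ncard_singLocus_monoidForm_le hA hB hA0 (isRelPrime_of_irreducible_monoidForm hA0 hirr) hfin

end NormalForm

/-! ### Irreducibility from finiteness of the singular locus -/

section Irreducible

variable {K : Type*} [Field K] [IsAlgClosed K]

/-- Fewer than `n` polynomials in `n` variables that vanish at the origin have another common
zero. -/
theorem MvPolynomial.exists_ne_zero_forall_eval_eq_zero {n : ℕ}
    (s : Finset (MvPolynomial (Fin n) K)) (hs : s.card < n) (h0 : ∀ f ∈ s, eval 0 f = 0) :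
    ∃ v : Fin n → K, v ≠ 0 ∧ ∀ f ∈ s, eval v f = 0 := by
  by_contra! h
  have hz : zeroLocus K (Ideal.span (s : Set (MvPolynomial (Fin n) K))) = {0} := by
    rw [zeroLocus_span]
    ext v
    simp only [Set.mem_ofPred_eq, Set.mem_singleton_iff, aeval_eq_eval, Finset.mem_coe]
    constructor
    · intro hv
      by_contra hne
      obtain ⟨f, hf, hf'⟩ := h v hne
      exact hf' (hv f hf)
    · rintro rfl
      exact h0
  -- By the Nullstellensatz the maximal ideal of the origin is minimal over the span, so Krull's
  -- height theorem bounds its height `n` by `s.card`.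
  have hrad := vanishingIdeal_zeroLocus_eq_radical (K := K)
    (Ideal.span (s : Set (MvPolynomial (Fin n) K)))
  rw [hz] at hrad
  have hmax : (vanishingIdeal K ({0} : Set (Fin n → K))).IsMaximal :=
    isMaximal_iff_eq_vanishingIdeal_singleton.2 ⟨0, rfl⟩
  have hmin : vanishingIdeal K ({0} : Set (Fin n → K)) ∈
      (Ideal.span (s : Set (MvPolynomial (Fin n) K))).minimalPrimes := by
    rw [← Ideal.radical_minimalPrimes, ← hrad]
    have := hmax.isPrime
    rw [Ideal.minimalPrimes_eq_subsingleton_self]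
    rfl
  have h1 := Ideal.height_le_card_of_mem_minimalPrimes_span_finset hmin
  rw [height_eq_of_isMaximal n _ hmax] at h1
  exact absurd (by exact_mod_cast h1) (not_le.2 hs)

/-- A surface with finitely many singular points is irreducible. -/
theorem irreducible_of_finite_singLocus {F : MvPolynomial (Fin 4) K} {d : ℕ}
    (hF : F.IsHomogeneous d) (hd : d ≠ 0) (h0 : F ≠ 0) (hfin : (singLocus F).Finite) :
    Irreducible F := by
  classical
  have : Infinite K := IsAlgClosed.instInfinite
  refine ⟨fun hu => ?_, fun G H hGH => ?_⟩
  · obtain ⟨c, -, hc⟩ := MvPolynomial.isUnit_iff_eq_C_of_isReduced.1 hu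
    exact hd (hF.inj_right (hc ▸ isHomogeneous_C _ c) h0)
  by_contra! hnu
  have hG : eval 0 G = 0 := by
    by_contra hne
    exact hnu.1 (hF.isUnit_of_dvd h0 ⟨H, hGH⟩ hne)
  have hH : eval 0 H = 0 := by
    by_contra hne
    exact hnu.2 (hF.isUnit_of_dvd h0 ⟨G, by rw [hGH, mul_comm]⟩ hne)
  have : Finite (singLocus F) := hfin
  -- A plane missing all the singular points; it still meets `G = H = 0`, where the product `G * H`
  -- is singular.
  obtain ⟨f, hf⟩ := Module.exists_dual_forall_apply_ne_zero (K := K)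
    (fun p : singLocus F => p.1.rep) fun p => p.1.rep_nonzero
  obtain ⟨v, hv, hv'⟩ := exists_ne_zero_forall_eval_eq_zero {G, H, linForm f}
    (lt_of_le_of_lt Finset.card_le_three (by norm_num)) (by
      simp only [Finset.mem_insert, Finset.mem_singleton]
      rintro _ (rfl | rfl | rfl)
      exacts [hG, hH, by rw [eval_linForm, map_zero]])
  have hvG : eval v G = 0 := hv' _ (by simp)
  have hvH : eval v H = 0 := hv' _ (by simp)
  have hvf : f v = 0 := by simpa using hv' (linForm f) (by simp)
  have hmem : Projectivization.mk K v hv ∈ singLocus F := by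
    rw [mk_mem_singLocus_iff hF, hGH]
    exact ⟨by simp [hvG], fun t => by simp [dirDeriv_mul, hvG, hvH]⟩
  obtain ⟨a, ha⟩ := Projectivization.exists_smul_eq_mk_rep K v hv
  refine hf ⟨_, hmem⟩ ?_
  change f (Projectivization.mk K v hv).rep = 0
  rw [← ha, Units.smul_def, map_smul, hvf, smul_zero]

end Irreducible

theorem mainTheorem11 (K : Type*) [Field K] [IsAlgClosed K] :
    (∀ F : MvPolynomial (Fin 4) K, F.IsHomogeneous 4 → (singLocus F).Finite →
      (∃ p : P3 K, multiplicityAt F p = 3) →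
        (singLocus F).ncard ≤ 7) ∧
    (∀ (d : ℕ) (F : MvPolynomial (Fin 4) K), F.IsHomogeneous d → IsNormalSurface F →
      (∃ p : P3 K, multiplicityAt F p + 1 = (d : ℕ∞)) →
        (singLocus F).ncard ≤ 1 + d * (d - 1) / 2) := by
  have : Infinite K := IsAlgClosed.instInfinite
  constructor
  · rintro F hF hfin ⟨p, hp⟩
    -- The zero form has multiplicity `⊤`, not 3.
    have h0 : F ≠ 0 := by
      rintro rfl
      simp [multiplicityAt, orderAt] at hp
    exact ncard_singLocus_le_of_isNormalSurface (m := 3) hF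
      ⟨irreducible_of_finite_singLocus hF (by norm_num) h0 hfin, hfin⟩ (by rw [hp]; rfl)
  · rintro d F hF hN ⟨p, hp⟩
    obtain _ | m := d
    · simp at hp
    · refine ncard_singLocus_le_of_isNormalSurface hF hN (p := p) ?_
      push_cast at hp
      exact (ENat.add_left_injective_of_ne_top ENat.one_ne_top) hp
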